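/- Almost all trees have quantum symmetry. For a finite simple graph $\Gamma=(V,E)$ with adjacency matrix $A$, let $C(\mathrm{QAut}(\Gamma))$ be the universal unital $C^*$-algebra generated by elements $u_{ij}$, $i,j\in V$, subject to the relations $u_{ij}^*=u_{ij}^2=u_{ij}$ and $\sum_{k\in V}u_{ik}=\sum_{k\in V}u_{kj}=1$ for all $i,j\in V$, and $uA=Au$, where $u=(u_{ij})_{i,j\in V}$ (this is the $C^*$-algebra of Banica's quantum automorphism group of $\Gamma$). The graph $\Gamma$ is said to have quantum symmetry if $C(\mathrm{QAut}(\Gamma))$ is non-commutative; equivalently, if the inclusion $\mathrm{Aut}(\Gamma)\subseteq\mathrm{QAut}(\Gamma)$ is strict. For $n\ge 1$ let $T_n$ be a tree drawn uniformly at random from the set of all labelled trees on the vertex set $\{1,\dots,n\}$. Then $$\lim_{n\to\infty}\mathbb{P}\bigl[T_n\text{ has quantum symmetry}\bigr]=1.$$ -/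

import Mathlib

open scoped ENNReal

noncomputable section

open Classical in
/-- Let `Γ` be a graph on the finite vertex set `V` with adjacency matrix `A`, and let `B` be a unital
ring with an involution. The matrix `u` with entries in `B` satisfies the defining relations of the
quantum automorphism group of `Γ` (in the sense of Banica): it is a magic unitary, i.e.
`u_ij^* = u_ij^2 = u_ij` and all rows and columns sum to `1`, and moreover `u A = A u`. -/
structure QAutRelations {V : Type} [Fintype V] (Γ : SimpleGraph V)
    {B : Type*} [Ring B] [StarRing B] (u : Matrix V V B) : Prop where
  star_eq : ∀ i j, star (u i j) = u i j
  sq_eq : ∀ i j, u i j * u i j = u i j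
  row_sum : ∀ i, ∑ k, u i k = 1
  col_sum : ∀ j, ∑ k, u k j = 1
  comm : u * Γ.adjMatrix B = Γ.adjMatrix B * u

/-- A representation of the relations of the quantum automorphism group of `Γ` in a non-zero
unital C*-algebra. -/
structure QAutRep {V : Type} [Fintype V] (Γ : SimpleGraph V) : Type 1 where
  /-- the C*-algebra -/
  alg : Type
  [cstar : CStarAlgebra alg]
  [nontriv : Nontrivial alg]
  /-- the matrix of images of the generators -/
  mat : Matrix V V alg
  rel : QAutRelations Γ mat

attribute [instance] QAutRep.cstar QAutRep.nontriv

/-- The C*-algebra of bounded families in a product of C*-algebras. -/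
instance lpInftyCStarAlgebra {I : Type*} {B : I → Type*} [∀ i, CStarAlgebra (B i)]
    [∀ i, Nontrivial (B i)] : CStarAlgebra (lp B ∞) where

section UniversalAlgebra

variable {V : Type} [Fintype V] (Γ : SimpleGraph V)

/-- The family of the `(i, j)` entries in all representations of the relations. It is bounded
since projections have norm at most `1`. -/
def qautGenFamily (i j : V) : lp (fun π : QAutRep Γ => π.alg) ∞ :=
  ⟨fun π => π.mat i j, memℓp_infty ⟨1, by
    rintro _ ⟨π, rfl⟩
    exact IsStarProjection.norm_le _ ⟨π.rel.sq_eq i j, π.rel.star_eq i j⟩⟩⟩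

/-- The C*-subalgebra generated by the universal matrix in the product of all representations. -/
def qautSubalgebra : StarSubalgebra ℂ (lp (fun π : QAutRep Γ => π.alg) ∞) :=
  (StarAlgebra.adjoin ℂ (Set.range fun p : V × V => qautGenFamily Γ p.1 p.2)).topologicalClosure

/-- `C(QAut(Γ))`: the universal unital C*-algebra generated by `u_ij` (`i, j ∈ V`), subject to the
relations `u_ij^* = u_ij^2 = u_ij`, `∑_k u_ik = ∑_k u_kj = 1` and `u A = A u`, i.e. the quotient of
`C(S_n^+)` by the relations `u A = A u`. It is built in the usual way, as the C*-algebra generated by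
the universal matrix `u` in the product of all representations of the relations. (A C*-algebra
generated by finitely many elements has at most continuum many elements, so up to isomorphism all
representations that are generated by the entries live on C*-algebras in `Type`.) -/
def CQAut : Type 1 := qautSubalgebra Γ

instance : CStarAlgebra (CQAut Γ) :=
  haveI : IsClosed (qautSubalgebra Γ : Set (lp (fun π : QAutRep Γ => π.alg) ∞)) :=
    StarSubalgebra.isClosed_topologicalClosure _
  StarSubalgebra.cstarAlgebra (qautSubalgebra Γ)

/-- The canonical generators `u_ij` of `C(QAut(Γ))`. -/
def qautGen (i j : V) : CQAut Γ :=
  ⟨qautGenFamily Γ i j, StarSubalgebra.le_topologicalClosure _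
    (StarAlgebra.subset_adjoin ℂ _ ⟨(i, j), rfl⟩)⟩

variable {Γ}

/-- Universal property, existence: every representation of the relations extends to a unital
*-homomorphism on `C(QAut(Γ))`. -/
def QAutRep.hom (π : QAutRep Γ) : CQAut Γ →⋆ₐ[ℂ] π.alg where
  toFun x := x.1 π
  map_one' := rfl
  map_mul' _ _ := rfl
  map_zero' := rfl
  map_add' _ _ := rfl
  commutes' _ := rfl
  map_star' _ := rfl

theorem QAutRep.hom_gen (π : QAutRep Γ) (i j : V) : π.hom (qautGen Γ i j) = π.mat i j := rfl

/-- Universal property, uniqueness. -/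
theorem CQAut.hom_ext {B : Type*} [CStarAlgebra B] {φ ψ : CQAut Γ →⋆ₐ[ℂ] B}
    (h : ∀ i j, φ (qautGen Γ i j) = ψ (qautGen Γ i j)) : φ = ψ := by
  have hφ : Continuous φ := (NonUnitalStarAlgHom.instContinuousLinearMapClassComplex
    (F := CQAut Γ →⋆ₐ[ℂ] B)).map_continuous φ
  have hψ : Continuous ψ := (NonUnitalStarAlgHom.instContinuousLinearMapClassComplex
    (F := CQAut Γ →⋆ₐ[ℂ] B)).map_continuous ψ
  refine StarAlgHom.ext_topologicalClosure (R := ℂ) (S := StarAlgebra.adjoin ℂ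
    (Set.range fun p : V × V => qautGenFamily Γ p.1 p.2)) hφ hψ ?_
  refine StarAlgHom.ext_adjoin ?_
  rintro ⟨_, _⟩ ⟨⟨i, j⟩, rfl⟩
  exact h i j

variable (Γ)

/-- The canonical generators satisfy the relations. -/
theorem qautGen_rel : QAutRelations Γ (Matrix.of (qautGen Γ)) where
  star_eq i j := by
    apply Subtype.ext; apply lp.ext; funext π; exact π.rel.star_eq i j
  sq_eq i j := by
    apply Subtype.ext; apply lp.ext; funext π; exact π.rel.sq_eq i j
  row_sum i := by
    apply Subtype.ext; apply lp.ext; funext π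
    change π.hom (∑ k, qautGen Γ i k) = 1
    rw [map_sum]; exact π.rel.row_sum i
  col_sum i := by
    apply Subtype.ext; apply lp.ext; funext π
    change π.hom (∑ k, qautGen Γ k i) = 1
    rw [map_sum]; exact π.rel.col_sum i
  comm := by
    refine Matrix.ext fun i j => ?_
    apply Subtype.ext; apply lp.ext; funext π
    have := congrFun (congrFun π.rel.comm i) j
    simp only [Matrix.mul_apply, Matrix.of_apply, SimpleGraph.adjMatrix_apply, mul_ite, ite_mul,
      mul_one, mul_zero, one_mul, zero_mul] at this ⊢
    change π.hom _ = π.hom _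
    simp only [map_sum, apply_ite π.hom, map_zero]
    exact this

/-- A finite graph `Γ` has quantum symmetry if `C(QAut(Γ))` is non-commutative; equivalently, if
`QAut(Γ)` is strictly larger than `Aut(Γ)`, see `hasQuantumSymmetry_iff`. -/
def HasQuantumSymmetry : Prop := ∃ a b : CQAut Γ, a * b ≠ b * a

end UniversalAlgebra

section ClassicalAutomorphisms

variable {V : Type} [Fintype V] (Γ : SimpleGraph V)

theorem finite_graphAut : Finite (Γ ≃g Γ) := DFunLike.finite _

open Classical in
/-- The coordinate functions on the group `Aut(Γ)` of permutation matrices commuting with `A`. -/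
def classicalMat : Matrix V V ((Γ ≃g Γ) → ℂ) := fun i j σ => if σ j = i then 1 else 0

open Classical in
theorem classicalMat_rel : QAutRelations Γ (classicalMat Γ) where
  star_eq i j := by ext σ; simp [classicalMat, apply_ite]
  sq_eq i j := by ext σ; simp [classicalMat]
  row_sum i := by
    ext σ
    simp only [classicalMat, Finset.sum_apply, Pi.one_apply]
    rw [Finset.sum_eq_single (σ.symm i)] <;> simp
    rintro b hb rfl; simp at hb
  col_sum i := by ext σ; simp [classicalMat, Finset.sum_apply]
  comm := by
    have hm : ∀ (i j : V) (σ : Γ ≃g Γ), classicalMat Γ i j σ = if σ j = i then 1 else 0 :=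
      fun _ _ _ => rfl
    ext i j σ
    simp only [Matrix.mul_apply, SimpleGraph.adjMatrix_apply, mul_ite, ite_mul,
      mul_one, mul_zero, one_mul, zero_mul, Finset.sum_apply]
    rw [Finset.sum_eq_single (σ.symm i), Finset.sum_eq_single (σ j)]
    · have := σ.map_adj_iff (v := σ.symm i) (w := j)
      simp at this
      by_cases h : Γ.Adj i (σ j) <;> simp_all
    · intro b _ hb; simp [hb.symm, ite_apply, hm]
    · simp
    · intro b _ hb
      have : σ b ≠ i := by rintro rfl; simp at hb
      simp [this, ite_apply, hm]
    · simp

/-- `C(Aut(Γ))`, with its coordinate functions, as a representation of the relations. -/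
def classicalRep : QAutRep Γ where
  alg := (Γ ≃g Γ) → ℂ
  cstar :=
    haveI := finite_graphAut Γ
    haveI := Fintype.ofFinite (Γ ≃g Γ)
    inferInstance
  nontriv :=
    haveI : Nonempty (Γ ≃g Γ) := ⟨RelIso.refl _⟩
    inferInstance
  mat := classicalMat Γ
  rel := classicalMat_rel Γ

theorem QAutRelations.map {B C : Type*} [CStarAlgebra B] [CStarAlgebra C] {u : Matrix V V B}
    (hu : QAutRelations Γ u) (χ : B →⋆ₐ[ℂ] C) : QAutRelations Γ (u.map χ) where
  star_eq i j := by simp only [Matrix.map_apply]; rw [← map_star, hu.star_eq]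
  sq_eq i j := by simp only [Matrix.map_apply]; rw [← map_mul, hu.sq_eq]
  row_sum i := by simp only [Matrix.map_apply]; rw [← map_sum, hu.row_sum, map_one]
  col_sum i := by simp only [Matrix.map_apply]; rw [← map_sum, hu.col_sum, map_one]
  comm := by
    refine Matrix.ext fun i j => ?_
    have := congrArg χ (congrFun (congrFun hu.comm i) j)
    simpa [Matrix.mul_apply, SimpleGraph.adjMatrix_apply, map_sum, apply_ite χ] using this

theorem existsUnique_of_sum_eq_one {c : V → ℂ} (h1 : ∀ i, c i = 0 ∨ c i = 1)
    (h2 : ∑ i, c i = 1) : ∃! i, c i = 1 := by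
  have h3 : ∑ i, c i = ((Finset.univ.filter fun i => c i = 1).card : ℂ) := by
    rw [Finset.card_filter, Nat.cast_sum]
    refine Finset.sum_congr rfl fun i _ => ?_
    rcases h1 i with h | h <;> simp [h]
  rw [h2] at h3
  have h4 : (Finset.univ.filter fun i => c i = 1).card = 1 := by exact_mod_cast h3.symm
  obtain ⟨i, hi⟩ := Finset.card_eq_one.1 h4
  refine ⟨i, ?_, fun j hj => ?_⟩
  · simpa using (Finset.ext_iff.1 hi i)
  · simpa [hj] using (Finset.ext_iff.1 hi j)

open Classical in
/-- The scalar solutions of the relations are the permutation matrices of automorphisms. -/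
theorem QAutRelations.eq_classical {u : Matrix V V ℂ} (hu : QAutRelations Γ u) :
    ∃ σ : Γ ≃g Γ, ∀ i j, u i j = classicalMat Γ i j σ := by
  have h01 : ∀ i j, u i j = 0 ∨ u i j = 1 := fun i j => by
    have h0 : u i j * (u i j - 1) = 0 := by rw [mul_sub, hu.sq_eq, mul_one, sub_self]
    rcases mul_eq_zero.1 h0 with h | h
    · exact Or.inl h
    · exact Or.inr (sub_eq_zero.1 h)
  choose f hf hf' using fun j => existsUnique_of_sum_eq_one (fun i => h01 i j) (hu.col_sum j)
  choose g hg hg' using fun i => existsUnique_of_sum_eq_one (fun j => h01 i j) (hu.row_sum i)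
  dsimp only at hf hf' hg hg'
  have huf : ∀ i j, u i j = if f j = i then 1 else 0 := fun i j => by
    split_ifs with h
    · rw [← h, hf]
    · exact (h01 i j).resolve_right fun h' => h (hf' j i h').symm
  have hgf : ∀ j, g (f j) = j := fun j => (hg' (f j) j (hf j)).symm
  have hfg : ∀ i, f (g i) = i := fun i => (hf' (g i) i (hg i)).symm
  refine ⟨⟨⟨f, g, hgf, hfg⟩, ?_⟩, huf⟩
  intro a b
  have hc := congrFun (congrFun hu.comm (f a)) b
  simp only [Matrix.mul_apply, SimpleGraph.adjMatrix_apply, huf] at hc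
  rw [Finset.sum_eq_single a, Finset.sum_eq_single (f b)] at hc
  · clear hf hf' hg hg' huf h01
    by_cases h1 : Γ.Adj a b <;> by_cases h2 : Γ.Adj (f a) (f b) <;>
      simp [h1, h2] at hc ⊢
  · intro k _ hk; simp [hk.symm]
  · simp
  · intro k _ hk
    have : f k ≠ f a := fun h => hk (by rw [← hgf k, h, hgf])
    simp [this]
  · simp

theorem eq_zero_of_characters {A : Type*} [CommCStarAlgebra A] (x : A)
    (hx : ∀ χ : A →⋆ₐ[ℂ] ℂ, χ x = 0) : x = 0 := by
  apply (gelfandTransform_isometry A).injective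
  rw [map_zero]
  ext χ
  exact hx { AlgHomClass.toAlgHom χ with map_star' := fun a => map_star χ a }

theorem eq_zero_of_characters_of_comm {A : Type*} [inst : CStarAlgebra A]
    (h : ∀ a b : A, a * b = b * a) (x : A) (hx : ∀ χ : A →⋆ₐ[ℂ] ℂ, χ x = 0) : x = 0 :=
  @eq_zero_of_characters A { inst with mul_comm := h } x hx

/-- `C(QAut(Γ))` is non-commutative if and only if the inclusion `Aut(Γ) ⊆ QAut(Γ)` is strict, i.e.
the canonical map `C(QAut(Γ)) → C(Aut(Γ))` sending generators to coordinate functions is not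
injective. -/
theorem hasQuantumSymmetry_iff :
    HasQuantumSymmetry Γ ↔ ¬ Function.Injective (classicalRep Γ).hom := by
  constructor
  · rintro ⟨a, b, hab⟩ h
    apply hab
    apply h
    rw [map_mul, map_mul]
    funext σ
    exact mul_comm (G := ℂ) _ _
  · contrapose
    intro h
    simp only [HasQuantumSymmetry, not_exists, not_not] at h
    rw [injective_iff_map_eq_zero]
    intro x hx
    refine eq_zero_of_characters_of_comm (A := CQAut Γ) h x fun χ => ?_
    obtain ⟨σ, hσ⟩ := ((qautGen_rel Γ).map Γ χ).eq_classical
    have key : χ = (Pi.evalStarAlgHom ℂ (fun _ : Γ ≃g Γ => ℂ) σ).comp (classicalRep Γ).hom :=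
      CQAut.hom_ext fun i j => hσ i j
    rw [key]
    exact congrFun hx σ

end ClassicalAutomorphisms

/-- The probability that a labelled tree on the vertex set `Fin n`, drawn uniformly at random,
has the property `P`. -/
def randomTreeProb (n : ℕ) (P : SimpleGraph (Fin n) → Prop) : ℝ :=
  ({T : SimpleGraph (Fin n) | T.IsTree ∧ P T}.ncard : ℝ) /
    ({T : SimpleGraph (Fin n) | T.IsTree}.ncard : ℝ)

end

/-! Two vertices with the same neighbourhood can be swapped. For two disjoint such pairs, the swaps
can carry noncommuting projections `p`, `q` as weights, which gives a representation with `u a a =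
p` and `u c c = q`. Two leaves of a tree with a common neighbour (a cherry) are such a pair, so two
disjoint cherries force quantum symmetry (`hasQuantumSymmetry_of_twins`).

That almost all trees on n vertices have two disjoint cherries follows from two switching arguments.
A tree with at most m leaves has at least n - 2m vertices of degree two. Contracting one and
rehanging it as a leaf is nearly injective, because the result has few leaves among which to find
it; such trees have proportion at most (m + 1)/(n - 2m) (`card_trees_few_leaves`). In a tree with
more than m leaves but no two disjoint cherries, moving one leaf next to another creates a cherry
that is easy to locate, since the result has at most 7 leaves in cherries; the proportion is at most
49n/m² (`card_trees_many_leaves_not_hasTwoCherries`). Both bounds vanish for m of order n^(3/4). -/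

noncomputable section

/-! ### Quantum symmetry from two pairs of twins -/

section TwinSymmetry

variable {V : Type} [Fintype V] {Γ : SimpleGraph V}

open Classical in
/-- The matrix `[i = j] e_i + [j = σ i] (1 - e_i)`, a superposition of the identity and of the
permutation `σ` with noncommutative weights. -/
def twinMat {B : Type*} [Ring B] (σ : V → V) (e : V → B) : Matrix V V B := fun i j =>
  (if i = j then e i else 0) + if σ i = j then 1 - e i else 0

-- The rows of `A` at `i` and `σ i` agree and the weights `e i`, `1 - e i` add up to 1, so `u A` and
-- `A u` both equal `A`. Constancy of `e` on the orbits of `σ` gives the column sums.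
open Classical in
theorem twinMat_rel {B : Type*} [Ring B] [StarRing B] {σ : V → V} (hσ : Function.Involutive σ)
    (hadj : ∀ i j, Γ.Adj (σ i) j ↔ Γ.Adj i j) {e : V → B} (he : ∀ i, IsStarProjection (e i))
    (heσ : ∀ i, e (σ i) = e i) : QAutRelations Γ (twinMat σ e) where
  star_eq i j := by
    have := (he i).isSelfAdjoint.star_eq
    unfold twinMat
    split_ifs <;> simp [this]
  sq_eq i j := by
    have := (he i).isIdempotentElem.eq
    unfold twinMat
    split_ifs <;> simp [this, mul_sub, sub_mul]
  row_sum i := by simp [twinMat, Finset.sum_add_distrib]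
  col_sum j := by
    have h : ∀ i, (if σ i = j then 1 - e i else 0) = if i = σ j then 1 - e i else 0 := fun i =>
      if_congr ⟨fun h => by rw [← h, hσ], fun h => by rw [h, hσ]⟩ rfl rfl
    simp [twinMat, Finset.sum_add_distrib, h, heσ]
  comm := by
    have hadj' : ∀ i j, Γ.Adj i (σ j) ↔ Γ.Adj i j := fun i j => by
      rw [Γ.adj_comm, hadj, Γ.adj_comm]
    ext i j
    have h : ∀ k, (if σ k = j then 1 - e k else 0) = if k = σ j then 1 - e k else 0 := fun k =>
      if_congr ⟨fun h => by rw [← h, hσ], fun h => by rw [h, hσ]⟩ rfl rfl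
    have h1 : (twinMat σ e * Γ.adjMatrix B) i j = Γ.adjMatrix B i j := by
      simp only [Matrix.mul_apply, twinMat, add_mul, ite_mul, zero_mul, Finset.sum_add_distrib,
        Finset.sum_ite_eq, Finset.mem_univ, if_true, SimpleGraph.adjMatrix_apply, hadj]
      rw [← add_mul]; simp
    have h2 : (Γ.adjMatrix B * twinMat σ e) i j = Γ.adjMatrix B i j := by
      simp only [Matrix.mul_apply, twinMat, h, mul_add, mul_ite, mul_zero, Finset.sum_add_distrib,
        Finset.sum_ite_eq', Finset.mem_univ, if_true, SimpleGraph.adjMatrix_apply, hadj', heσ]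
      rw [← mul_add]; simp
    rw [h1, h2]

open scoped ComplexOrder in
theorem exists_noncommuting_starProjections : ∃ p q : CStarMatrix (Fin 2) (Fin 2) ℂ,
    IsStarProjection p ∧ IsStarProjection q ∧ p * q ≠ q * p := by
  refine ⟨CStarMatrix.ofMatrix !![1, 0; 0, 0],
    CStarMatrix.ofMatrix !![1 / 2, 1 / 2; 1 / 2, 1 / 2], ⟨?_, ?_⟩, ⟨?_, ?_⟩, ?_⟩
  · ext i j; fin_cases i <;> fin_cases j <;> simp [CStarMatrix.mul_apply]
  · ext i j; fin_cases i <;> fin_cases j <;> simp [CStarMatrix.star_apply]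
  · ext i j; fin_cases i <;> fin_cases j <;> simp [CStarMatrix.mul_apply] <;> norm_num
  · ext i j; fin_cases i <;> fin_cases j <;> simp [CStarMatrix.star_apply]
  · intro h
    have := congrFun (congrFun h 0) 1
    simp [CStarMatrix.mul_apply] at this

open scoped ComplexOrder in
open Classical in
/-- A graph with two disjoint pairs of twins has quantum symmetry. -/
theorem hasQuantumSymmetry_of_twins {a b c d : V} (hac : a ≠ c) (had : a ≠ d) (hbc : b ≠ c)
    (hbd : b ≠ d) (hab' : a ≠ b) (hcd' : c ≠ d) (hab : ∀ x, Γ.Adj a x ↔ Γ.Adj b x)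
    (hcd : ∀ x, Γ.Adj c x ↔ Γ.Adj d x) : HasQuantumSymmetry Γ := by
  obtain ⟨p, q, hp, hq, hpq⟩ := exists_noncommuting_starProjections
  let σ : V → V := fun x => if x = a then b else if x = b then a else
    if x = c then d else if x = d then c else x
  -- Outside the two pairs any projection would do: `σ` fixes the vertex, and the diagonal entry is
  -- `e x + (1 - e x) = 1`.
  let e : V → CStarMatrix (Fin 2) (Fin 2) ℂ := fun x =>
    if x = a ∨ x = b then p else if x = c ∨ x = d then q else 1
  have hσ : Function.Involutive σ := by
    intro x
    dsimp only [σ]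
    split_ifs <;> simp_all
  have hadj : ∀ i j, Γ.Adj (σ i) j ↔ Γ.Adj i j := by
    intro i j
    dsimp only [σ]
    split_ifs <;> simp_all
  have he : ∀ i, IsStarProjection (e i) := by
    intro i
    dsimp only [e]
    split_ifs
    · exact hp
    · exact hq
    · exact ⟨one_mul 1, star_one _⟩
  have heσ : ∀ i, e (σ i) = e i := by
    intro i
    dsimp only [σ, e]
    split_ifs <;> simp_all [eq_comm]
  let π : QAutRep Γ :=
    { alg := CStarMatrix (Fin 2) (Fin 2) ℂ
      nontriv := ⟨⟨p * q, q * p, hpq⟩⟩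
      mat := twinMat σ e
      rel := twinMat_rel hσ hadj he heσ }
  refine ⟨qautGen Γ a a, qautGen Γ c c, fun h => hpq ?_⟩
  have h1 := congrArg π.hom h
  rw [map_mul, map_mul, QAutRep.hom_gen, QAutRep.hom_gen] at h1
  have ha : π.mat a a = p := by simp [π, twinMat, e, σ, hab'.symm]
  have hc : π.mat c c = q := by
    simp [π, twinMat, e, σ, hac.symm, hbc.symm, hcd'.symm]
  rw [ha, hc] at h1
  exact h1

end TwinSymmetry
end

/-! ### Moving leaves and contracting vertices of degree two -/

section TreeSurgery

variable {V : Type*} {T : SimpleGraph V}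

namespace SimpleGraph

/-- `v` is a leaf of `T`, and `p` is its unique neighbour. -/
def IsLeafAt (T : SimpleGraph V) (v p : V) : Prop := ∀ x, T.Adj v x ↔ x = p

/-- `v` is a leaf of `T`. -/
def IsLeaf (T : SimpleGraph V) (v : V) : Prop := ∃ p, T.IsLeafAt v p

/-- `v` and `w` are distinct leaves of `T` with a common neighbour. -/
def IsCherry (T : SimpleGraph V) (v w : V) : Prop := v ≠ w ∧ ∃ p, T.IsLeafAt v p ∧ T.IsLeafAt w p

theorem IsLeafAt.adj {v p : V} (h : T.IsLeafAt v p) : T.Adj v p := (h p).2 rfl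

theorem IsLeafAt.ne {v p : V} (h : T.IsLeafAt v p) : v ≠ p := h.adj.ne

theorem IsLeafAt.eq {v p q : V} (h : T.IsLeafAt v p) (h' : T.IsLeafAt v q) : p = q :=
  (h' p).1 h.adj

theorem IsCherry.symm {v w : V} (h : T.IsCherry v w) : T.IsCherry w v :=
  ⟨h.1.symm, let ⟨p, h1, h2⟩ := h.2; ⟨p, h2, h1⟩⟩

theorem IsCherry.trans {u v w : V} (h : T.IsCherry u v) (h' : T.IsCherry v w) (hne : u ≠ w) :
    T.IsCherry u w := by
  obtain ⟨-, p, h1, h2⟩ := h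
  obtain ⟨-, q, h3, h4⟩ := h'
  obtain rfl := h2.eq h3
  exact ⟨hne, p, h1, h4⟩

/-- Detach `v` from all its neighbours and attach it to `x` instead. -/
def moveTo (T : SimpleGraph V) (v x : V) : SimpleGraph V where
  Adj a b := a ≠ b ∧ ((a ≠ v ∧ b ≠ v ∧ T.Adj a b) ∨ (a = v ∧ b = x) ∨ (b = v ∧ a = x))
  symm := ⟨fun a b h => ⟨h.1.symm, by
    rcases h.2 with h | h | h
    · exact Or.inl ⟨h.2.1, h.1, h.2.2.symm⟩
    · exact Or.inr (Or.inr h)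
    · exact Or.inr (Or.inl h)⟩⟩
  loopless := ⟨fun a h => h.1 rfl⟩

theorem moveTo_adj_of_ne {v x a b : V} (ha : a ≠ v) (hb : b ≠ v) :
    (T.moveTo v x).Adj a b ↔ T.Adj a b := by
  simp only [moveTo]
  exact ⟨by simp [ha, hb], fun h => ⟨h.ne, Or.inl ⟨ha, hb, h⟩⟩⟩

theorem isLeafAt_moveTo {v x : V} (hx : x ≠ v) : (T.moveTo v x).IsLeafAt v x := by
  intro y
  simp only [moveTo]
  grind

/-- A leaf move is undone by knowing the leaf and its old neighbour; this makes the second switching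
injective. -/
theorem moveTo_moveTo {v x p : V} (h : T.IsLeafAt v p) : (T.moveTo v x).moveTo v p = T := by
  have hne := h.ne
  ext a b
  by_cases ha : a = v
  · subst ha
    rw [isLeafAt_moveTo hne.symm, h]
  by_cases hb : b = v
  · subst hb
    rw [adj_comm, isLeafAt_moveTo hne.symm, adj_comm, h]
  rw [moveTo_adj_of_ne ha hb, moveTo_adj_of_ne ha hb]

/-- A connected graph obtained from a tree by exchanging an edge is a tree. -/
theorem IsTree.exchange [Finite V] (hT : T.IsTree) {T' : SimpleGraph V} (hc : T'.Connected)
    {e f : Sym2 V} (he : e ∈ T.edgeSet) (hsub : T'.edgeSet ⊆ insert f (T.edgeSet \ {e})) :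
    T'.IsTree := by
  have h1 := (isTree_iff_connected_and_card.1 hT).2
  have h2 := hc.card_vert_le_card_edgeSet_add_one
  refine isTree_iff_connected_and_card.2 ⟨hc, ?_⟩
  have hfin : T.edgeSet.Finite := Set.toFinite _
  have h3 : T'.edgeSet.ncard ≤ T.edgeSet.ncard := by
    calc T'.edgeSet.ncard ≤ (insert f (T.edgeSet \ {e})).ncard := Set.ncard_le_ncard hsub
      _ ≤ (T.edgeSet \ {e}).ncard + 1 := Set.ncard_insert_le _ _
      _ = T.edgeSet.ncard := Set.ncard_sdiff_singleton_add_one he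
  rw [← Nat.card_coe_set_eq, ← Nat.card_coe_set_eq] at h3
  omega

theorem IsTree.moveTo [Finite V] (hT : T.IsTree) {v p x : V} (h : T.IsLeafAt v p) (hx : x ≠ v) :
    (T.moveTo v x).IsTree := by
  classical
  have := Fintype.ofFinite V
  have hdeg : T.degree v = 1 := degree_eq_one_iff_existsUnique_adj.2 ⟨p, h.adj, fun y hy => (h y).1 hy⟩
  have hind := hT.1.induce_compl_singleton_of_degree_eq_one hdeg
  let φ : T.induce {v}ᶜ →g T.moveTo v x :=
    ⟨fun y => y.1, fun {a b} hab => (moveTo_adj_of_ne a.2 b.2).2 hab⟩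
  have hr : ∀ y, (T.moveTo v x).Reachable x y := by
    intro y
    by_cases hy : y = v
    · subst hy
      exact (isLeafAt_moveTo hx).adj.symm.reachable
    · exact (hind.preconnected ⟨x, hx⟩ ⟨y, hy⟩).map φ
  have hc : (T.moveTo v x).Connected :=
    (connected_iff _).2 ⟨fun a b => (hr a).symm.trans (hr b), ⟨x⟩⟩
  refine hT.exchange hc (e := s(v, p)) (f := s(v, x)) h.adj fun e => ?_
  induction e using Sym2.ind with | _ a b =>
  intro hab
  simp only [mem_edgeSet, Set.mem_insert_iff, Set.mem_sdiff, Set.mem_singleton_iff, Sym2.eq_iff] at hab ⊢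
  obtain ⟨-, h1 | h1 | h1⟩ := hab
  · exact Or.inr ⟨h1.2.2, by rintro (⟨h2, -⟩ | ⟨-, h2⟩) <;> simp [h2] at h1⟩
  · exact Or.inl (Or.inl h1)
  · exact Or.inl (Or.inr ⟨h1.2, h1.1⟩)

/-- Contract a vertex `v` with neighbours `a` and `b` and reattach it as a leaf at `w`. -/
def splice (T : SimpleGraph V) (v a b w : V) : SimpleGraph V := (T ⊔ edge a b).moveTo v w

/-- Adjacent vertices of a tree have different distances from `v`, whereas `a` and `b` are both at
distance 1. -/
theorem IsTree.not_adj_of_common_neighbor (hT : T.IsTree) {v a b : V} (ha : T.Adj v a)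
    (hb : T.Adj v b) : ¬ T.Adj a b := by
  intro hab
  have h := hT.dist_ne_of_adj v hab
  rw [dist_eq_one_iff_adj.2 ha, dist_eq_one_iff_adj.2 hb] at h
  exact h rfl

/-- Exchanging the edge `v b` for `a b` gives a tree `R` in which `v` is a leaf at `a`. Since
`moveTo` discards all edges at `v`, splicing is the same as moving that leaf of `R`. -/
theorem IsTree.splice [Finite V] (hT : T.IsTree) {v a b w : V} (hab : a ≠ b)
    (hv : ∀ x, T.Adj v x ↔ x = a ∨ x = b) (hw : w ≠ v) : (T.splice v a b w).IsTree := by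
  have hva : T.Adj v a := (hv a).2 (Or.inl rfl)
  have hvb : T.Adj v b := (hv b).2 (Or.inr rfl)
  have hnab := hT.not_adj_of_common_neighbor hva hvb
  let R : SimpleGraph V := (T ⊔ edge a b).deleteEdges {s(v, b)}
  have hR : ∀ y z, R.Adj y z ↔ (T.Adj y z ∨ s(y, z) = s(a, b)) ∧ s(y, z) ≠ s(v, b) := by
    intro y z
    simp only [R, deleteEdges_adj, sup_adj, edge_adj, Set.mem_singleton_iff, Sym2.eq_iff]
    grind
  have hRva : R.Adj v a := by
    rw [hR]; refine ⟨Or.inl hva, ?_⟩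
    simp only [ne_eq, Sym2.eq_iff]
    rintro (h | h)
    · exact hab h.2
    · exact hva.ne h.2.symm
  have hRab : R.Adj a b := by
    rw [hR]; refine ⟨Or.inr rfl, ?_⟩
    simp only [ne_eq, Sym2.eq_iff]
    rintro (h | h)
    · exact hva.ne h.1.symm
    · exact hab h.1
  have hreach : ∀ y z, T.Adj y z → R.Reachable y z := by
    intro y z h
    by_cases he : s(y, z) = s(v, b)
    · rcases Sym2.eq_iff.1 he with ⟨rfl, rfl⟩ | ⟨rfl, rfl⟩
      · exact hRva.reachable.trans hRab.reachable
      · exact (hRva.reachable.trans hRab.reachable).symm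
    · exact ((hR y z).2 ⟨Or.inl h, he⟩).reachable
  have hc : R.Connected := by
    refine (connected_iff _).2 ⟨fun y z => ?_, ⟨v⟩⟩
    obtain ⟨p⟩ := hT.1.preconnected y z
    induction p with
    | nil => exact Reachable.refl _
    | cons h _ ih => exact (hreach _ _ h).trans ih
  have hRt : R.IsTree := by
    refine hT.exchange hc (e := s(v, b)) (f := s(a, b)) hvb fun e => ?_
    induction e using Sym2.ind with | _ y z =>
    intro h
    rw [mem_edgeSet, hR] at h
    simp only [Set.mem_insert_iff, Set.mem_sdiff, Set.mem_singleton_iff, mem_edgeSet]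
    tauto
  have hleaf : R.IsLeafAt v a := by
    intro x
    rw [hR, hv]
    simp only [ne_eq, Sym2.eq_iff]
    have := hva.ne
    have := hvb.ne
    grind
  have hs : T.splice v a b w = R.moveTo v w := by
    ext y z
    by_cases hy : y = v
    · subst hy
      rw [isLeafAt_moveTo hw, SimpleGraph.splice, isLeafAt_moveTo hw]
    by_cases hz : z = v
    · subst hz
      rw [adj_comm, SimpleGraph.splice, isLeafAt_moveTo hw, adj_comm, isLeafAt_moveTo hw]
    rw [SimpleGraph.splice, moveTo_adj_of_ne hy hz, moveTo_adj_of_ne hy hz, hR]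
    simp only [sup_adj, edge_adj, Sym2.eq_iff, ne_eq]
    grind
  rw [hs]
  exact hRt.moveTo hleaf hw

theorem isLeafAt_splice {v a b w : V} (hw : w ≠ v) : (T.splice v a b w).IsLeafAt v w :=
  isLeafAt_moveTo hw

theorem splice_adj_of_ne {v a b w y z : V} (hab : a ≠ b) (hy : y ≠ v) (hz : z ≠ v) :
    (T.splice v a b w).Adj y z ↔ T.Adj y z ∨ s(y, z) = s(a, b) := by
  rw [SimpleGraph.splice, moveTo_adj_of_ne hy hz, sup_adj, edge_adj, Sym2.eq_iff]
  grind

/-- The right-hand side involves only the spliced graph, `v` and the unordered pair `s(a, b)`, so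
these data determine `T`. -/
theorem adj_iff_splice (hT : T.IsTree) {v a b w y z : V} (hab : a ≠ b)
    (hv : ∀ x, T.Adj v x ↔ x = a ∨ x = b) : T.Adj y z ↔
      (y ≠ v ∧ z ≠ v ∧ (T.splice v a b w).Adj y z ∧ s(y, z) ≠ s(a, b)) ∨
      (y = v ∧ z ∈ s(a, b)) ∨ (z = v ∧ y ∈ s(a, b)) := by
  have hva : T.Adj v a := (hv a).2 (Or.inl rfl)
  have hvb : T.Adj v b := (hv b).2 (Or.inr rfl)
  have hnab := hT.not_adj_of_common_neighbor hva hvb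
  have hna := hva.ne
  have hnb := hvb.ne
  by_cases hy : y = v
  · subst hy
    rw [hv]; simp; grind
  by_cases hz : z = v
  · subst hz
    rw [adj_comm, hv]; simp; grind
  rw [splice_adj_of_ne hab hy hz]
  simp only [hy, hz, ne_eq, not_false_eq_true, true_and, false_and, or_false]
  refine ⟨fun h => ⟨Or.inl h, fun h' => ?_⟩, fun h => h.1.resolve_right h.2⟩
  rcases Sym2.eq_iff.1 h' with ⟨rfl, rfl⟩ | ⟨rfl, rfl⟩
  · exact hnab h
  · exact hnab h.symm

end SimpleGraph

end TreeSurgery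

noncomputable section

/-! ### Double counting, and the rarity of trees with few leaves -/

section Switching

open Finset

/-- Double counting: if every element of `A` has at least `k` continuations, every element of `B` has
at most `l` continuations, and the pairs over `A` inject into the pairs over `B`, then
`#A * k ≤ #B * l`. -/
theorem card_mul_le_card_mul_of_injection {α β γ δ : Type*} {A : Finset α} {B : Finset β}
    {f : α → Finset γ} {g : β → Finset δ} {k l : ℕ} (hf : ∀ a ∈ A, k ≤ #(f a))
    (hg : ∀ b ∈ B, #(g b) ≤ l) (Φ : α → γ → β × δ)
    (hΦ : ∀ a ∈ A, ∀ c ∈ f a, (Φ a c).1 ∈ B ∧ (Φ a c).2 ∈ g (Φ a c).1)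
    (hinj : ∀ a ∈ A, ∀ c ∈ f a, ∀ a' ∈ A, ∀ c' ∈ f a', Φ a c = Φ a' c' → a = a' ∧ c = c') :
    #A * k ≤ #B * l := by
  have h1 : #A * k ≤ #(A.sigma f) := by
    rw [card_sigma, ← smul_eq_mul]
    exact card_nsmul_le_sum _ _ _ hf
  have h2 : #(B.sigma g) ≤ #B * l := by
    rw [card_sigma, ← smul_eq_mul]
    exact sum_le_card_nsmul _ _ _ hg
  have h3 : #(A.sigma f) ≤ #(B.sigma g) := by
    refine card_le_card_of_injOn (fun x => ⟨(Φ x.1 x.2).1, (Φ x.1 x.2).2⟩) ?_ ?_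
    · rintro ⟨a, c⟩ h
      rw [mem_coe, mem_sigma] at h ⊢
      exact hΦ a h.1 c h.2
    · rintro ⟨a, c⟩ h ⟨a', c'⟩ h' he
      rw [mem_coe, mem_sigma] at h h'
      have he1 := congrArg Sigma.fst he
      have he2 : (Φ a c).2 = (Φ a' c').2 := eq_of_heq (Sigma.mk.inj_iff.1 he).2
      obtain ⟨rfl, rfl⟩ := hinj a h.1 c h.2 a' h'.1 c' h'.2 (Prod.ext he1 he2)
      rfl
  exact h1.trans (h3.trans h2)

namespace SimpleGraph

variable {V : Type*} [Fintype V] {T : SimpleGraph V}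

open Classical in
/-- The set of leaves. -/
def leaves (T : SimpleGraph V) : Finset V := univ.filter T.IsLeaf

theorem mem_leaves {v : V} : v ∈ T.leaves ↔ T.IsLeaf v := by simp [leaves]

open Classical in
theorem isLeaf_iff_degree_eq_one {v : V} : T.IsLeaf v ↔ T.degree v = 1 := by
  rw [degree_eq_one_iff_existsUnique_adj]
  exact ⟨fun ⟨p, hp⟩ => ⟨p, hp.adj, fun y hy => (hp y).1 hy⟩,
    fun ⟨p, hp, h⟩ => ⟨p, fun y => ⟨h y, fun e => e ▸ hp⟩⟩⟩

open Classical in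
/-- A tree with few leaves has many vertices of degree two. -/
theorem IsTree.card_le_card_degree_two (hT : T.IsTree) [Nontrivial V] :
    Fintype.card V ≤ #(univ.filter fun v => T.degree v = 2) + 2 * #T.leaves := by
  have h1 := T.sum_degrees_eq_twice_card_edges
  have h2 := hT.card_edgeFinset
  -- All degrees are positive, so a vertex falls short of degree 3 by 2 if it is a leaf, by 1 if it
  -- has degree two, and otherwise not at all.
  have h3 : ∑ v : V, 3 ≤ ∑ v, (T.degree v + 2 * (if T.IsLeaf v then 1 else 0) +
      if T.degree v = 2 then 1 else 0) := by
    refine sum_le_sum fun v _ => ?_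
    have := hT.1.preconnected.degree_pos_of_nontrivial v
    rw [isLeaf_iff_degree_eq_one]
    split_ifs <;> omega
  rw [sum_add_distrib, sum_add_distrib, ← mul_sum, ← card_filter, ← card_filter, h1] at h3
  simp only [sum_const, card_univ, smul_eq_mul] at h3
  have h4 : #T.leaves = #(univ.filter fun v => T.IsLeaf v) := by rw [leaves]
  omega

-- No vertex other than `v` loses degree: `a` and `b` trade the neighbour `v` for each other, and
-- `w` gains `v`.
open Classical in
theorem IsTree.leaves_splice_subset (hT : T.IsTree) [Nontrivial V] {v a b w : V} (hab : a ≠ b)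
    (hv : ∀ x, T.Adj v x ↔ x = a ∨ x = b) :
    (T.splice v a b w).leaves ⊆ insert v T.leaves := by
  have hva : T.Adj v a := (hv a).2 (Or.inl rfl)
  have hvb : T.Adj v b := (hv b).2 (Or.inr rfl)
  have hnab := hT.not_adj_of_common_neighbor hva hvb
  intro x hx
  rw [mem_insert]
  by_cases hxv : x = v
  · exact Or.inl hxv
  refine Or.inr (mem_leaves.2 ?_)
  obtain ⟨p, hp⟩ := mem_leaves.1 hx
  have hother : ∀ y, y ≠ v → T.Adj x y → y = p := fun y hy h =>
    (hp y).1 ((splice_adj_of_ne hab hxv hy).2 (Or.inl h))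
  by_cases hxab : x = a ∨ x = b
  · refine ⟨v, fun y => ⟨fun h => ?_, fun h => h ▸ ((hv x).2 hxab).symm⟩⟩
    by_contra hy
    have hyp := hother y hy h
    rcases hxab with rfl | rfl
    · have : b = p := (hp b).1 ((splice_adj_of_ne hab hxv hvb.ne').2 (Or.inr rfl))
      exact hnab (this.trans hyp.symm ▸ h)
    · have : a = p := (hp a).1 ((splice_adj_of_ne hab hxv hva.ne').2 (Or.inr Sym2.eq_swap))
      exact hnab (this.trans hyp.symm ▸ h.symm)
  · have hxv' : ¬ T.Adj x v := fun h => hxab ((hv x).1 h.symm)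
    have hxy : ∀ y, T.Adj x y → y = p := fun y h => hother y (fun e => hxv' (e ▸ h)) h
    obtain ⟨y, hy⟩ := hT.1.preconnected.exists_adj_of_nontrivial x
    exact ⟨p, fun z => ⟨hxy z, fun e => e.trans (hxy y hy).symm ▸ hy⟩⟩

variable (V) in
open Classical in
/-- The set of trees on `V` with property `P`. -/
def treesWith (P : SimpleGraph V → Prop) : Finset (SimpleGraph V) :=
  univ.filter fun T => T.IsTree ∧ P T

theorem mem_treesWith {P : SimpleGraph V → Prop} : T ∈ treesWith V P ↔ T.IsTree ∧ P T := by
  simp [treesWith]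

open Classical in
/-- Only few trees have few leaves. -/
theorem card_trees_few_leaves [Nontrivial V] (m : ℕ) :
    #(treesWith V fun T => #T.leaves ≤ m) * (Fintype.card V - 2 * m) ≤
      #(treesWith V fun _ => True) * (m + 1) := by
  -- The common factor n - 1 counts the attachment points `w ≠ v` on one side and the edges of the
  -- new tree on the other.
  have hpos : 0 < Fintype.card V - 1 := by have := Fintype.one_lt_card (α := V); omega
  refine Nat.le_of_mul_le_mul_right ?_ hpos
  rw [mul_assoc, mul_assoc]
  -- A choice of the two neighbours of `v`; the value at vertices of other degrees is never used.
  have hnb : ∀ (T : SimpleGraph V) (v : V), ∃ e : V × V, T.degree v = 2 →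
      e.1 ≠ e.2 ∧ ∀ x, T.Adj v x ↔ x = e.1 ∨ x = e.2 := by
    intro T v
    by_cases h : T.degree v = 2
    · obtain ⟨a, b, hab, he⟩ := card_eq_two.1 h
      refine ⟨(a, b), fun _ => ⟨hab, fun x => ?_⟩⟩
      rw [← mem_neighborFinset, he]; simp
    · exact ⟨(v, v), fun h' => absurd h' h⟩
  choose e he using hnb
  refine card_mul_le_card_mul_of_injection
    (B := (treesWith V fun T => #T.leaves ≤ m + 1))
    (f := fun T => (univ.filter fun v => T.degree v = 2).sigma fun v => univ.erase v)
    (g := fun T => T.leaves ×ˢ T.edgeFinset) (k := (Fintype.card V - 2 * m) * (Fintype.card V - 1))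
    (l := (m + 1) * (Fintype.card V - 1))
    -- The new leaf and the edge that replaced it suffice to go back; `w` is read off as the only
    -- neighbour of the new leaf.
    ?_ ?_ (fun T c => (T.splice c.1 (e T c.1).1 (e T c.1).2 c.2, c.1, s((e T c.1).1, (e T c.1).2)))
    ?_ ?_ |>.trans ?_
  · intro T h
    obtain ⟨hT, hm⟩ := mem_treesWith.1 h
    have := hT.card_le_card_degree_two
    simp only [card_sigma, mem_univ, card_erase_of_mem, card_univ, sum_const, smul_eq_mul]
    gcongr
    omega
  · intro T h
    obtain ⟨hT, hm⟩ := mem_treesWith.1 h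
    have := hT.card_edgeFinset
    rw [card_product]
    gcongr
    omega
  · rintro T h ⟨v, w⟩ hc
    obtain ⟨hT, hm⟩ := mem_treesWith.1 h
    simp only [mem_sigma, mem_filter, mem_univ, true_and, mem_erase, and_true] at hc
    obtain ⟨hab, hv⟩ := he T v hc.1
    refine ⟨mem_treesWith.2 ⟨hT.splice hab hv hc.2, ?_⟩, ?_⟩
    · exact (card_le_card (hT.leaves_splice_subset hab hv)).trans
        ((card_insert_le _ _).trans (by omega))
    · simp only [mem_product, mem_leaves, mem_edgeFinset, mem_edgeSet]
      refine ⟨⟨w, isLeafAt_splice hc.2⟩, ?_⟩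
      exact (splice_adj_of_ne hab ((hv _).2 (Or.inl rfl)).ne' ((hv _).2 (Or.inr rfl)).ne').2
        (Or.inr rfl)
  · rintro T h ⟨v, w⟩ hc T' h' ⟨v', w'⟩ hc' heq
    obtain ⟨hT, -⟩ := mem_treesWith.1 h
    obtain ⟨hT', -⟩ := mem_treesWith.1 h'
    simp only [mem_sigma, mem_filter, mem_univ, true_and, mem_erase, and_true] at hc hc'
    simp only [Prod.mk.injEq] at heq
    obtain ⟨h1, rfl, h3⟩ := heq
    obtain ⟨hab, hv⟩ := he T v hc.1
    obtain ⟨hab', hv'⟩ := he T' v hc'.1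
    have hTT : T = T' := by
      ext y z
      rw [adj_iff_splice hT (w := w) hab hv, adj_iff_splice hT' (w := w') hab' hv', h1, h3]
    have hl := isLeafAt_splice (T := T) (a := (e T v).1) (b := (e T v).2) hc.2
    rw [h1] at hl
    exact ⟨hTT, by rw [hl.eq (isLeafAt_splice hc'.2)]⟩
  · gcongr
    exact fun T h => mem_treesWith.2 ⟨(mem_treesWith.1 h).1, trivial⟩

end SimpleGraph

end Switching
end

noncomputable section

/-! ### Trees with many leaves but no two disjoint cherries -/

section Cherries

open Finset

namespace SimpleGraph

variable {V : Type*} {T : SimpleGraph V}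

/-- `T` has two disjoint cherries. -/
def HasTwoCherries (T : SimpleGraph V) : Prop :=
  ∃ a b c d, a ≠ c ∧ a ≠ d ∧ b ≠ c ∧ b ≠ d ∧ T.IsCherry a b ∧ T.IsCherry c d

/-- Moving a leaf `v` with neighbour `u` creates no cherry that avoids `u` and `v`. -/
theorem IsCherry.of_moveTo {v u q x y : V} (hv : T.IsLeafAt v u) (hq : q ≠ v)
    (hxv : x ≠ v) (hxu : x ≠ u) (hyv : y ≠ v) (hyu : y ≠ u) (h : (T.moveTo v q).IsCherry x y) :
    T.IsCherry x y := by
  obtain ⟨hne, p, hx, hy⟩ := h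
  have hpv : p ≠ v := by
    rintro rfl
    have h1 := (isLeafAt_moveTo hq x).1 hx.adj.symm
    have h2 := (isLeafAt_moveTo hq y).1 hy.adj.symm
    exact hne (h1.trans h2.symm)
  -- Only `u` loses a neighbour when `v` moves away, so no other old vertex can become a leaf.
  have key : ∀ z, z ≠ v → z ≠ u → (T.moveTo v q).IsLeafAt z p → T.IsLeafAt z p := by
    intro z hzv hzu hz t
    by_cases ht : t = v
    · subst ht
      rw [adj_comm, hv]
      exact ⟨fun h => absurd h hzu, fun h => absurd h.symm hpv⟩
    · rw [← moveTo_adj_of_ne hzv ht, hz]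
  exact ⟨hne, p, key x hxv hxu hx, key y hyv hyu hy⟩

theorem IsLeafAt.moveTo {v q w : V} (hw : T.IsLeafAt w q) (hwv : w ≠ v) (hq : q ≠ v) :
    (T.moveTo v q).IsLeafAt w q := by
  intro y
  by_cases hy : y = v
  · subst hy
    rw [adj_comm, isLeafAt_moveTo hq]
    exact ⟨fun h => absurd h hw.ne, fun h => absurd h.symm hq⟩
  · rw [moveTo_adj_of_ne hwv hy, hw]

theorem exists_isTree [Nonempty V] : ∃ T : SimpleGraph V, T.IsTree := by
  obtain ⟨T, -, hT⟩ := (connected_top (V := V)).exists_isTree_le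
  exact ⟨T, hT⟩

variable [Fintype V]

/-- Two leaves attached to each other would be a whole component. Hence the neighbour of a leaf `w`
is never another leaf `v`, and `v` can be moved there. -/
theorem Connected.not_isLeafAt_of_isLeafAt (hT : T.Connected) (hV : 2 < Fintype.card V) {v w : V}
    (hv : T.IsLeafAt v w) : ¬ T.IsLeafAt w v := by
  classical
  intro hw
  have h : ∀ x y, T.Walk x y → x = v ∨ x = w → y = v ∨ y = w := by
    intro x y p
    induction p with
    | nil => exact id
    | cons hadj _ ih =>
      rintro (rfl | rfl)
      · exact ih (Or.inr ((hv _).1 hadj))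
      · exact ih (Or.inl ((hw _).1 hadj))
  have hsub : (univ : Finset V) ⊆ {v, w} := fun y _ => by
    obtain ⟨p⟩ := hT.preconnected v y
    simpa using h v y p (Or.inl rfl)
  have := (card_le_card hsub).trans card_le_two
  rw [card_univ] at this
  omega

open Classical in
/-- The set of leaves that belong to a cherry. -/
def cherryLeaves (T : SimpleGraph V) : Finset V := univ.filter fun x => ∃ y, T.IsCherry x y

theorem mem_cherryLeaves {x : V} : x ∈ T.cherryLeaves ↔ ∃ y, T.IsCherry x y := by
  simp [cherryLeaves]

/-- By transitivity of `IsCherry`, all cherry leaves hang on one vertex; four of them would split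
into two disjoint cherries. -/
theorem card_cherryLeaves_le (hT : ¬ T.HasTwoCherries) : #T.cherryLeaves ≤ 3 := by
  classical
  by_cases h : ∃ a b, T.IsCherry a b
  · obtain ⟨a, b, hab⟩ := h
    have key : ∀ x ∈ T.cherryLeaves, x ≠ a → x ≠ b → T.IsCherry x a ∧ T.IsCherry x b := by
      intro x hx hxa hxb
      obtain ⟨y, hy⟩ := mem_cherryLeaves.1 hx
      by_cases hya : y = a
      · subst hya
        exact ⟨hy, hy.trans hab hxb⟩
      by_cases hyb : y = b
      · subst hyb
        exact ⟨hy.trans hab.symm hxa, hy⟩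
      · exact absurd ⟨x, y, a, b, hxa, hxb, hya, hyb, hy, hab⟩ hT
    by_cases hc : ∃ c ∈ T.cherryLeaves, c ≠ a ∧ c ≠ b
    · obtain ⟨c, hc, hca, hcb⟩ := hc
      refine (card_le_card (fun d hd => ?_)).trans (card_le_three (a := a) (b := b) (c := c))
      by_contra hd'
      simp only [mem_insert, mem_singleton, not_or] at hd'
      exact hT ⟨d, a, c, b, hd'.2.2, hd'.2.1, hca.symm, hab.1, (key d hd hd'.1 hd'.2.1).1,
        (key c hc hca hcb).2⟩
    · push Not at hc
      refine (card_le_card (t := {a, b}) (fun d hd => ?_)).trans (card_le_two.trans (by norm_num))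
      have := hc d hd
      simp only [mem_insert, mem_singleton]
      tauto
  · push Not at h
    have : T.cherryLeaves = ∅ := by
      ext x
      simp [mem_cherryLeaves, h]
    simp [this]

/-- 7 = 2 + 3 + 1 + 1: the vertices `v` and `u`, the old cherry leaves, and at most one new partner
for each of `v` and `u`. Two new partners of the same vertex would form a cherry avoiding `v` and
`u`, which was already one in `T`. -/
theorem card_cherryLeaves_moveTo_le (hT : ¬ T.HasTwoCherries) {v u q : V} (hv : T.IsLeafAt v u)
    (hq : q ≠ v) : #(T.moveTo v q).cherryLeaves ≤ 7 := by
  classical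
  let A : V → Finset V := fun y => univ.filter fun x =>
    x ∉ T.cherryLeaves ∧ x ≠ v ∧ x ≠ u ∧ (T.moveTo v q).IsCherry x y
  have hA : ∀ y, #(A y) ≤ 1 := by
    intro y
    rw [card_le_one]
    intro x hx z hz
    simp only [A, mem_filter, mem_univ, true_and] at hx hz
    by_contra hne
    have h := hx.2.2.2.trans hz.2.2.2.symm hne
    exact hx.1 (mem_cherryLeaves.2 ⟨z, h.of_moveTo hv hq hx.2.1 hx.2.2.1 hz.2.1 hz.2.2.1⟩)
  have hsub : (T.moveTo v q).cherryLeaves ⊆ ({v, u} ∪ T.cherryLeaves) ∪ (A v ∪ A u) := by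
    intro x hx
    obtain ⟨y, hy⟩ := mem_cherryLeaves.1 hx
    simp only [mem_union, mem_insert, mem_singleton, A, mem_filter, mem_univ, true_and]
    by_cases hxc : x ∈ T.cherryLeaves
    · tauto
    by_cases hxv : x = v
    · tauto
    by_cases hxu : x = u
    · tauto
    by_cases hyv : y = v
    · subst hyv; tauto
    by_cases hyu : y = u
    · subst hyu; tauto
    exact absurd (mem_cherryLeaves.2 ⟨y, hy.of_moveTo hv hq hxv hxu hyv hyu⟩) hxc
  have h1 := card_union_le ({v, u} ∪ T.cherryLeaves) (A v ∪ A u)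
  have h2 := card_union_le {v, u} T.cherryLeaves
  have h3 := card_union_le (A v) (A u)
  have h4 := card_le_two (a := v) (b := u)
  have h5 := card_cherryLeaves_le hT
  have h6 := hA v
  have h7 := hA u
  have h8 := card_le_card hsub
  omega

open Classical in
/-- Only few trees have many leaves but no two disjoint cherries. -/
theorem card_trees_many_leaves_not_hasTwoCherries (hV : 2 < Fintype.card V) (m : ℕ) :
    #(treesWith V fun T => m < #T.leaves ∧ ¬ T.HasTwoCherries) * (m * m) ≤
      #(treesWith V fun _ => True) * (7 * 7 * Fintype.card V) := by
  have hpar : ∀ (T : SimpleGraph V) (v : V), ∃ p, T.IsLeaf v → T.IsLeafAt v p := by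
    intro T v
    by_cases h : T.IsLeaf v
    · exact ⟨h.choose, fun _ => h.choose_spec⟩
    · exact ⟨v, fun h' => absurd h' h⟩
  choose par hpar using hpar
  refine card_mul_le_card_mul_of_injection
    (B := treesWith V fun T => #T.cherryLeaves ≤ 7)
    (f := fun T => T.leaves.sigma fun v => T.leaves.erase v)
    (g := fun T => (T.cherryLeaves ×ˢ T.cherryLeaves) ×ˢ (univ : Finset V))
    (l := 7 * 7 * Fintype.card V) ?_ ?_
    -- `v` and `w` form a cherry in the new tree, so they are among 7 * 7 pairs; the old neighbour
    -- of `v` may be any vertex.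
    (fun T c => (T.moveTo c.1 (par T c.2), (c.1, c.2), par T c.1)) ?_ ?_ |>.trans ?_
  · intro T h
    obtain ⟨hT, hm, -⟩ := mem_treesWith.1 h
    rw [card_sigma, sum_congr rfl fun v hv => card_erase_of_mem hv, sum_const, smul_eq_mul]
    gcongr
    omega
  · intro T h
    obtain ⟨hT, hm⟩ := mem_treesWith.1 h
    rw [card_product, card_product, card_univ]
    gcongr
  · rintro T h ⟨v, w⟩ hc
    obtain ⟨hT, hm, hbad⟩ := mem_treesWith.1 h
    simp only [mem_sigma, mem_erase, mem_leaves] at hc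
    obtain ⟨hv, hwv, hw⟩ := hc
    have hv' := hpar T v hv
    have hw' := hpar T w hw
    have hq : par T w ≠ v := fun e => by
      rw [e] at hw'
      have : par T v = w := ((hv' w).1 hw'.adj.symm).symm
      rw [this] at hv'
      exact hT.1.not_isLeafAt_of_isLeafAt hV hv' hw'
    refine ⟨mem_treesWith.2 ⟨hT.moveTo hv' hq, card_cherryLeaves_moveTo_le hbad hv' hq⟩, ?_⟩
    have hch : (T.moveTo v (par T w)).IsCherry v w :=
      ⟨hwv.symm, _, isLeafAt_moveTo hq, hw'.moveTo hwv hq⟩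
    simp only [mem_product, mem_cherryLeaves, mem_univ, and_true]
    exact ⟨⟨w, hch⟩, ⟨v, hch.symm⟩⟩
  · rintro T h ⟨v, w⟩ hc T' h' ⟨v', w'⟩ hc' heq
    simp only [mem_sigma, mem_erase, mem_leaves] at hc hc'
    simp only [Prod.mk.injEq] at heq
    obtain ⟨h1, ⟨rfl, rfl⟩, h3⟩ := heq
    refine ⟨?_, rfl⟩
    rw [← moveTo_moveTo (x := par T w) (hpar T v hc.1), h1, h3, moveTo_moveTo (hpar T' v hc'.1)]
  · gcongr
    exact fun T h => mem_treesWith.2 ⟨(mem_treesWith.1 h).1, trivial⟩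

theorem HasTwoCherries.hasQuantumSymmetry {V : Type} [Fintype V] {T : SimpleGraph V}
    (h : T.HasTwoCherries) : HasQuantumSymmetry T := by
  obtain ⟨a, b, c, d, hac, had, hbc, hbd, ⟨hab, p, hap, hbp⟩, ⟨hcd, q, hcq, hdq⟩⟩ := h
  exact hasQuantumSymmetry_of_twins hac had hbc hbd hab hcd
    (fun x => (hap x).trans (hbp x).symm) fun x => (hcq x).trans (hdq x).symm

end SimpleGraph

end Cherries

/-! ### Choice of parameters and the limit -/

section Limit

open Finset SimpleGraph

theorem one_sub_le_randomTreeProb {n m : ℕ} (hn : 2 < n) (hm : 0 < m) (hmn : 2 * m < n) :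
    1 - ((m + 1 : ℝ) / (n - 2 * m) + 49 * n / m ^ 2) ≤
      randomTreeProb n fun T => HasQuantumSymmetry T := by
  classical
  have : Nontrivial (Fin n) := Fin.nontrivial_iff_two_le.2 hn.le
  have h1 := card_trees_few_leaves (V := Fin n) m
  have h2 := card_trees_many_leaves_not_hasTwoCherries (V := Fin n) (by simpa using hn) m
  have hN : {T : SimpleGraph (Fin n) | T.IsTree}.ncard = #(treesWith (Fin n) fun _ => True) := by
    rw [← Set.ncard_coe_finset]; congr 1; ext T; simp [mem_treesWith]
  have hcover : #(treesWith (Fin n) fun _ => True) ≤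
      #(treesWith (Fin n) fun T => #T.leaves ≤ m) +
      #(treesWith (Fin n) fun T => m < #T.leaves ∧ ¬ T.HasTwoCherries) +
      {T : SimpleGraph (Fin n) | T.IsTree ∧ HasQuantumSymmetry T}.ncard := by
    have hG : {T : SimpleGraph (Fin n) | T.IsTree ∧ HasQuantumSymmetry T}.ncard =
        #(treesWith (Fin n) fun T => HasQuantumSymmetry T) := by
      rw [← Set.ncard_coe_finset]; congr 1; ext T; simp [mem_treesWith]
    rw [hG]
    refine (card_le_card (fun T hT => ?_)).trans ((card_union_le _ _).trans
      (Nat.add_le_add_right (card_union_le _ _) _))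
    simp only [mem_union, mem_treesWith] at hT ⊢
    have := HasTwoCherries.hasQuantumSymmetry (T := T)
    have := le_or_gt #T.leaves m
    tauto
  have hNpos : 0 < #(treesWith (Fin n) fun _ => True) := by
    obtain ⟨T, hT⟩ := exists_isTree (V := Fin n)
    exact card_pos.2 ⟨T, mem_treesWith.2 ⟨hT, trivial⟩⟩
  rw [Fintype.card_fin] at h1 h2
  rw [randomTreeProb, hN]
  generalize #(treesWith (Fin n) fun _ => True) = N at *
  generalize #(treesWith (Fin n) fun T => #T.leaves ≤ m) = A at *
  generalize #(treesWith (Fin n) fun T => m < #T.leaves ∧ ¬ T.HasTwoCherries) = B at *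
  generalize {T : SimpleGraph (Fin n) | T.IsTree ∧ HasQuantumSymmetry T}.ncard = G at *
  have hN' : (0 : ℝ) < N := by exact_mod_cast hNpos
  have hm' : (0 : ℝ) < m := by exact_mod_cast hm
  have hd : (0 : ℝ) < n - 2 * m := by
    have : (2 * m : ℝ) < n := by exact_mod_cast hmn
    linarith
  have h1' : (A : ℝ) * (n - 2 * m) ≤ N * (m + 1) := by
    have := (Nat.cast_le (α := ℝ)).2 h1
    rw [Nat.cast_mul, Nat.cast_sub hmn.le] at this
    push_cast at this
    exact this
  have h2' : (B : ℝ) * m ^ 2 ≤ N * (49 * n) := by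
    have := (Nat.cast_le (α := ℝ)).2 h2
    push_cast at this
    linarith
  have hc' : (N : ℝ) ≤ A + B + G := by exact_mod_cast hcover
  have e1 : (A : ℝ) / N ≤ (m + 1) / (n - 2 * m) := by
    rw [div_le_div_iff₀ hN' hd]; linarith
  have e2 : (B : ℝ) / N ≤ 49 * n / m ^ 2 := by
    rw [div_le_div_iff₀ hN' (by positivity)]; linarith
  have e3 : (1 : ℝ) ≤ A / N + B / N + G / N := by
    rw [← add_div, ← add_div, le_div_iff₀ hN']; linarith
  linarith

theorem randomTreeProb_le_one (n : ℕ) (P : SimpleGraph (Fin n) → Prop) :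
    randomTreeProb n P ≤ 1 := by
  refine div_le_one_of_le₀ ?_ (Nat.cast_nonneg _)
  have h : {T : SimpleGraph (Fin n) | T.IsTree ∧ P T}.ncard ≤
      {T : SimpleGraph (Fin n) | T.IsTree}.ncard :=
    Set.ncard_le_ncard (fun T hT => hT.1) (Set.toFinite _)
  exact_mod_cast h

/-- With `m = s ^ 3`, the first error is of order 1/s by `s ^ 3 + 1 ≤ 2 * s ^ 3`; the second is at
most 49 · 16 / s², and 784 / s is enough. -/
theorem one_sub_le_randomTreeProb_of_pow {n s : ℕ} (hs : 2 < s) (h1 : s ^ 4 ≤ n)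
    (h2 : n ≤ 16 * s ^ 4) :
    1 - (2 / ((s : ℝ) - 2) + 784 / s) ≤ randomTreeProb n fun T => HasQuantumSymmetry T := by
  have hs' : (2 : ℝ) < s := by exact_mod_cast hs
  have hs3 : 2 * s ^ 3 < s ^ 4 := by
    rw [pow_succ s 3, mul_comm]; exact Nat.mul_lt_mul_of_pos_left hs (by positivity)
  have hn : 2 < n := by
    have : s ≤ s ^ 4 := Nat.le_self_pow (by norm_num) s
    omega
  refine le_trans ?_ (one_sub_le_randomTreeProb (m := s ^ 3) hn (by positivity) (hs3.trans_le h1))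
  have h1' : (s : ℝ) ^ 4 ≤ n := by exact_mod_cast h1
  have h2' : (n : ℝ) ≤ 16 * s ^ 4 := by exact_mod_cast h2
  have hp : (1 : ℝ) ≤ s ^ 3 := one_le_pow₀ (by linarith)
  have hs3' : (2 : ℝ) * s ^ 3 < s ^ 4 := by exact_mod_cast hs3
  push_cast
  have e1 : ((s : ℝ) ^ 3 + 1) / (n - 2 * s ^ 3) ≤ 2 / ((s : ℝ) - 2) := by
    calc ((s : ℝ) ^ 3 + 1) / (n - 2 * s ^ 3) ≤ (2 * s ^ 3) / (s ^ 4 - 2 * s ^ 3) := by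
          gcongr; linarith
      _ = 2 / ((s : ℝ) - 2) := by
          have : (s : ℝ) - 2 ≠ 0 := by linarith
          have : (s : ℝ) ≠ 0 := by linarith
          rw [show (s : ℝ) ^ 4 - 2 * s ^ 3 = (s - 2) * s ^ 3 by ring]
          field_simp
  have e2 : 49 * (n : ℝ) / ((s : ℝ) ^ 3) ^ 2 ≤ 784 / s := by
    rw [div_le_div_iff₀ (by positivity) (by linarith)]
    calc 49 * (n : ℝ) * s ≤ 49 * (16 * s ^ 4) * s := by gcongr
      _ = 784 * (s ^ 5 * 1) := by ring
      _ ≤ 784 * (s ^ 5 * s) := by gcongr; linarith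
      _ = 784 * (s ^ 3) ^ 2 := by ring
  linarith

theorem tendsto_sqrt_atTop : Filter.Tendsto Nat.sqrt Filter.atTop Filter.atTop :=
  Filter.tendsto_atTop_atTop.2 fun b => ⟨b * b, fun _ h => Nat.le_sqrt.2 h⟩

end Limit
end

/-- Almost all trees have quantum symmetry. -/
theorem theorem4p4 :
    Filter.Tendsto (fun n : ℕ => randomTreeProb n fun T => HasQuantumSymmetry T)
      Filter.atTop (nhds 1) := by
  -- The nested root is an integer fourth root s of n: s⁴ ≤ n ≤ (s + 1)⁴ ≤ (2s)⁴, whence the factor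
  -- 16.
  have hs : Filter.Tendsto (fun n : ℕ => Nat.sqrt (Nat.sqrt n)) Filter.atTop Filter.atTop :=
    tendsto_sqrt_atTop.comp tendsto_sqrt_atTop
  have hsR := (tendsto_natCast_atTop_atTop (R := ℝ)).comp hs
  have hlim : Filter.Tendsto (fun n : ℕ => 1 - (2 / ((Nat.sqrt (Nat.sqrt n) : ℝ) - 2) +
      784 / (Nat.sqrt (Nat.sqrt n) : ℝ))) Filter.atTop (nhds 1) := by
    have h1 := (Filter.tendsto_atTop_add_const_right _ (-2 : ℝ) hsR).const_div_atTop (2 : ℝ)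
    have h2 := hsR.const_div_atTop (784 : ℝ)
    simpa [sub_eq_add_neg] using (h1.add h2).const_sub 1
  refine tendsto_of_tendsto_of_tendsto_of_le_of_le' hlim tendsto_const_nhds ?_
    (Filter.Eventually.of_forall fun n => randomTreeProb_le_one n _)
  filter_upwards [hs.eventually_gt_atTop 2] with n hn
  refine one_sub_le_randomTreeProb_of_pow hn ?_ ?_
  · calc (Nat.sqrt (Nat.sqrt n)) ^ 4 = (Nat.sqrt (Nat.sqrt n) ^ 2) ^ 2 := by ring
      _ ≤ (Nat.sqrt n) ^ 2 := Nat.pow_le_pow_left (Nat.sqrt_le' _) 2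
      _ ≤ n := Nat.sqrt_le' _
  · have h1 : n < (Nat.sqrt n + 1) ^ 2 := Nat.lt_succ_sqrt' n
    have h2 : Nat.sqrt n < (Nat.sqrt (Nat.sqrt n) + 1) ^ 2 := Nat.lt_succ_sqrt' _
    calc n ≤ (Nat.sqrt n + 1) ^ 2 := h1.le
      _ ≤ ((Nat.sqrt (Nat.sqrt n) + 1) ^ 2) ^ 2 := Nat.pow_le_pow_left h2 2
      _ ≤ ((2 * Nat.sqrt (Nat.sqrt n)) ^ 2) ^ 2 := by gcongr; omega
      _ = 16 * Nat.sqrt (Nat.sqrt n) ^ 4 := by ring
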